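/- Let $n\ge 4$ be even. Greek indices run from $0$ to $n-1$, Roman indices from $1$ to $n-1$, and repeated indices are summed. Let $U$ be a relatively open subset of the half space $\{x\in\mathbb R^n : x^0\ge 0\}$ (a boundary adapted coordinate domain), $D=U\cap\{x^0=0\}$, and let $g=(g_{\alpha\beta})$ be a continuous Riemannian metric on $U$ with inverse $(g^{\alpha\beta})$. Put $\mathcal L_l=(g^{\alpha\beta}\partial_\alpha\partial_\beta)^l$ (all derivatives falling on the argument) and $\mathcal L=\mathcal L_1$. Consider the following equations for the $N=n(n+1)/2$ unknowns $u^t=g_{\alpha\beta}=g_{\beta\alpha}$. They are regarded as linear equations, with the coefficients $g^{\alpha\beta}$ of the displayed terms given by the metric. "l.o.t." stands for arbitrary linear terms (with arbitrary coefficients) of order strictly lower than that of the displayed operators, together with inhomogeneous terms. On $U$, the system $$\mathcal L_{n/2}\,g_{\alpha\beta}+\text{l.o.t.}=0 .$$ On $D$, the boundary equations: * order $0$: $g_{ij}=h_{ij}$, where $h$ is given; * order $2$(a): $\mathcal L g_{ij}+\text{l.o.t.}=0$; * order $2$(b), which replace the equations of order $1$, $g^{\eta\beta}\partial_\eta g_{\alpha\beta}-\frac12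 g^{\eta\beta}\partial_\alpha g_{\eta\beta}=0$: $$g^{\gamma0}g^{\eta\beta}\partial_\eta\partial_\gamma g_{0\beta}-\tfrac12 g^{\gamma0}g^{\eta\beta}\partial_0\partial_\gamma g_{\eta\beta}+\text{l.o.t.}=0$$ and, for each $i$, $$\begin{aligned}&\tfrac{2(2-n)(g^{00})^2}{n-1}g^{jk}\partial_i\partial_j g_{0k}-g^{00}g^{jk}\partial_j\partial_k g_{0i}-\tfrac{(2-n)(g^{00})^2}{n-1}g^{jk}\partial_0\partial_i g_{jk}+g^{0j}g^{0k}\partial_j\partial_k g_{0i}\\&\quad-g^{0\gamma}g^{0j}\partial_\gamma\partial_i g_{0j}+g^{0\gamma}g^{\eta j}\partial_\eta\partial_\gamma g_{ij}-\tfrac12 g^{0\gamma}g^{jk}\partial_\gamma\partial_i g_{jk}-\tfrac12 g^{0\gamma}g^{00}\partial_\gamma\partial_i g_{00}+\text{l.o.t.}=0;\end{aligned}$$ * order $3$: for each $\alpha$, $g^{\eta\beta}\partial_\eta\mathcal L g_{\alpha\beta}+\text{l.o.t.}=0$; * order $2l$, for $2\le l\le n/2-1$: $\mathcal L_l\,g_{\alpha\beta}+\text{l.o.t.}=0$.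 (Equations with two free indices are taken once for each unordered pair of indices.) Write the system as $L_{st}(\partial)u^t=F_s$ and the boundary equations as $B_{rt}(\partial)u^t=\phi_r$. Give the equations of the system weight $w(L_s)=0$, the unknowns weight $w(u^t)=n$, and a boundary equation of order $s$ weight $w(B_r)=s-n$. Let $L'_{st}$ and $B'_{rt}$ be the principal parts, i.e. the parts of order exactly $w(L_s)+w(u^t)$ and $w(B_r)+w(u^t)$ respectively. Then: 1. These weights are admissible: $\operatorname{ord}L_{st}\le w(L_s)+w(u^t)$ on $U$, $\operatorname{ord}B_{rt}\le w(B_r)+w(u^t)$ on $D$, and $\max_s w(L_s)=0$. 2. The system is uniformly elliptic on every compact $K\subset U$: with $2m=\deg_\xi\det L'(\xi)$, there is $a>0$ such that $a^{-1}|\xi|^{2m}\le|\det L'(\xi)|\le a|\xi|^{2m}$ at all points of $K$ and for all real covectors $\xi$, where $|\xi|$ is the Euclidean norm. 3. At every point of $D$ the number of boundary equations is $m$. 4. At every point $p\in D$ the boundary equations satisfy the Agmon–Douglis–Nirenberg complementing condition for the system: let $\nu=(g^{00})^{-1/2}dx^0$ be the inward unit normal covector, and let $\xi$ be a real covector at $p$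 which is not a multiple of $\nu$, i.e. which represents a nonzero element of $T_p^*D=T_p^*U/\mathbb R\nu$. Let $M^+(\tau)=\prod_r(\tau-\tau_r)$, where the $\tau_r$ are the roots with positive imaginary part, with multiplicity, of $\det L'(\xi+\tau\nu)$. Then the rows of $B'(\xi+\tau\nu)\operatorname{adj}L'(\xi+\tau\nu)$ are linearly independent modulo $M^+$: if $c^r\in\mathbb C$ and each component of $\sum_r c^r\,[B'(\xi+\tau\nu)\operatorname{adj}L'(\xi+\tau\nu)]_r$ is divisible by $M^+(\tau)$ in $\mathbb C[\tau]$, then all $c^r=0$. -/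

import Mathlib

open MvPolynomial

noncomputable section

/-! ### Linear differential operators, weights and principal parts

A scalar linear differential operator in the coordinates `x^0, …, x^d` is given, at each point, by
its total symbol: a polynomial in which the variable `X α` stands for `∂_α`. A matrix of
differential operators is a function from points to matrices of such polynomials. -/

/-- The operator has order at most `k`; the zero operator has order at most any integer. -/
def OrderLE {d : ℕ} (p : MvPolynomial (Fin (d + 1)) ℝ) (k : ℤ) : Prop :=
  ∀ m ∈ p.support, (m.degree : ℤ) ≤ k

/-- The operator has order strictly less than `k`; for `k = 0` this means that it is zero. -/
def OrderLT {d : ℕ} (p : MvPolynomial (Fin (d + 1)) ℝ) (k : ℕ) : Prop :=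
  ∀ m ∈ p.support, m.degree < k

/-- The part of order exactly `k` (zero if there is none, in particular if `k < 0`). -/
def orderPart {d : ℕ} (k : ℤ) (p : MvPolynomial (Fin (d + 1)) ℝ) :
    MvPolynomial (Fin (d + 1)) ℝ :=
  if 0 ≤ k then homogeneousComponent k.toNat p else 0

/-- The principal part of a matrix of operators, with respect to weights `w` of its rows and weights
`wu` of the unknowns: in the entry `(r, t)`, the part of order exactly `w r + wu t`. -/
def principalPart {d : ℕ} {R T : Type*} (w : R → ℤ) (wu : T → ℤ)
    (A : Matrix R T (MvPolynomial (Fin (d + 1)) ℝ)) :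
    Matrix R T (MvPolynomial (Fin (d + 1)) ℝ) :=
  Matrix.of fun r t => orderPart (w r + wu t) (A r t)

/-- `wL`, `wu`, `wB` are admissible weights for the equations `L` on `U`, the unknowns, and the
boundary conditions `B` on `D`, normalized so that the largest of the `wL s` is zero. -/
def AdmissibleWeights {d : ℕ} {T R : Type*} (U D : Set (Fin (d + 1) → ℝ))
    (L : (Fin (d + 1) → ℝ) → Matrix T T (MvPolynomial (Fin (d + 1)) ℝ))
    (B : (Fin (d + 1) → ℝ) → Matrix R T (MvPolynomial (Fin (d + 1)) ℝ))
    (wL wu : T → ℤ) (wB : R → ℤ) : Prop :=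
  (∀ x ∈ U, ∀ s t, OrderLE (L x s t) (wL s + wu t)) ∧
  (∀ x ∈ D, ∀ r t, OrderLE (B x r t) (wB r + wu t)) ∧
  (∀ s, wL s ≤ 0) ∧ (∃ s, wL s = 0)

/-! ### Uniform ellipticity and the complementing condition -/

/-- Uniform ellipticity on `K` of a system with principal part `L'`: with `2m` the degree of
`det L'(ξ)` in `ξ`, the quotient of `|det L'(ξ)|` by `|ξ|^(2m)` is bounded above and away from zero,
uniformly in the point and in the real covector `ξ`. -/
def UniformlyEllipticOn {d : ℕ} {T : Type*} [Fintype T] [DecidableEq T]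
    (K : Set (Fin (d + 1) → ℝ))
    (L' : (Fin (d + 1) → ℝ) → Matrix T T (MvPolynomial (Fin (d + 1)) ℝ)) : Prop :=
  ∃ a : ℝ, 0 < a ∧ ∀ x ∈ K, ∀ ξ : Fin (d + 1) → ℝ,
    a⁻¹ * ‖WithLp.toLp 2 ξ‖ ^ (L' x).det.totalDegree ≤ |eval ξ (L' x).det| ∧
    |eval ξ (L' x).det| ≤ a * ‖WithLp.toLp 2 ξ‖ ^ (L' x).det.totalDegree

/-- `A(ξ + τ ν)` as a matrix of complex polynomials in the single variable `τ`. -/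
def symbolAlong {d : ℕ} {R T : Type*} (ξ ν : Fin (d + 1) → ℝ)
    (A : Matrix R T (MvPolynomial (Fin (d + 1)) ℝ)) : Matrix R T (Polynomial ℂ) :=
  A.map (aeval fun α =>
    Polynomial.C (ξ α : ℂ) + Polynomial.C (ν α : ℂ) * (Polynomial.X : Polynomial ℂ))

/-- `M⁺(τ)`: the product of `τ - τ_r` over the roots `τ_r` of `det L'(ξ + τ ν)` with positive
imaginary part, counted with multiplicity. -/
def mPlus {d : ℕ} {T : Type*} [Fintype T] [DecidableEq T] (ξ ν : Fin (d + 1) → ℝ)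
    (L' : Matrix T T (MvPolynomial (Fin (d + 1)) ℝ)) : Polynomial ℂ :=
  (((symbolAlong ξ ν L').det.roots.filter fun z => 0 < z.im).map
    fun z => Polynomial.X - Polynomial.C z).prod

/-- The complementing condition at a boundary point with inward unit normal covector `ν`, for a
system with principal part `L'` and boundary conditions with principal part `B'`, both taken at that
point: the rows of `B'(ξ + τ ν) adj L'(ξ + τ ν)` are linearly independent over `ℂ` modulo `M⁺(τ)`.
The cotangent space of the boundary is the quotient of the full cotangent space by the line spanned
by `ν`; `ξ` runs through all representatives of all nonzero elements of it. -/
def ComplementingAt {d : ℕ} {T R : Type*} [Fintype T] [DecidableEq T] [Fintype R]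
    (ν : Fin (d + 1) → ℝ) (L' : Matrix T T (MvPolynomial (Fin (d + 1)) ℝ))
    (B' : Matrix R T (MvPolynomial (Fin (d + 1)) ℝ)) : Prop :=
  ∀ ξ : Fin (d + 1) → ℝ, (∀ c : ℝ, ξ ≠ c • ν) →
    ∀ c : R → ℂ,
      (∀ q : T, mPlus ξ ν L' ∣
        ∑ r, Polynomial.C (c r) * (symbolAlong ξ ν B' * (symbolAlong ξ ν L').adjugate) r q) →
      ∀ r, c r = 0

/-! ### The boundary value problem for the metric

The dimension is `n = d + 1`. Greek indices are elements of `Fin (d + 1)`, with `0` the index of the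
boundary defining coordinate `x^0`; Roman indices are `j.succ` with `j : Fin d`. The unknowns are the
components `g_{αβ}`, indexed by the unordered pairs `s(α, β)`. -/

/-- The boundary portion of a coordinate domain in the half space `x^0 ≥ 0`. -/
def boundaryPortion {d : ℕ} (U : Set (Fin (d + 1) → ℝ)) : Set (Fin (d + 1) → ℝ) :=
  {x ∈ U | x 0 = 0}

/-- The inward pointing unit normal covector `(g^{00})^{-1/2} dx^0`. -/
def unitConormal {d : ℕ} (g : Matrix (Fin (d + 1)) (Fin (d + 1)) ℝ) : Fin (d + 1) → ℝ :=
  Pi.single 0 (1 / √(g⁻¹ 0 0))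

/-- The operator `ℒ_l`, the `l`-fold trace `(g^{αβ} ∂_α ∂_β)^l` of `2l` coordinate derivatives. -/
def traceOp {d : ℕ} (g : Matrix (Fin (d + 1)) (Fin (d + 1)) ℝ) (l : ℕ) :
    MvPolynomial (Fin (d + 1)) ℝ :=
  (∑ α, ∑ β, C (g⁻¹ α β) * X α * X β) ^ l

/-- The highest order part `δ_{st} ℒ_{n/2}` of the system. -/
def systemOp {d : ℕ} (g : Matrix (Fin (d + 1)) (Fin (d + 1)) ℝ) :
    Matrix (Sym2 (Fin (d + 1))) (Sym2 (Fin (d + 1))) (MvPolynomial (Fin (d + 1)) ℝ) :=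
  Matrix.diagonal fun _ => traceOp g ((d + 1) / 2)

/-- The boundary equations, grouped in blocks. -/
inductive BdyRow (d : ℕ) : Type
  /-- order 0, for `1 ≤ i, j ≤ n - 1` -/
  | order0 (p : Sym2 (Fin d))
  /-- order 2(a), for `1 ≤ i, j ≤ n - 1` -/
  | order2a (p : Sym2 (Fin d))
  /-- order 2(b), the normal derivative of the equation of order 1 with index `0` -/
  | order2bNormal
  /-- order 2(b), the modified normal derivative of the equation of order 1 with index `i ≥ 1` -/
  | order2bTangential (i : Fin d)
  /-- order 3, for `0 ≤ α ≤ n - 1` -/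
  | order3 (α : Fin (d + 1))
  /-- order `2l` with `2 ≤ l ≤ n/2 - 1`, for `0 ≤ α, β ≤ n - 1` -/
  | orderEven (l : Finset.Icc 2 ((d + 1) / 2 - 1)) (p : Sym2 (Fin (d + 1)))

/-- The set of boundary equations as a disjoint union. -/
def BdyRow.equivSum (d : ℕ) :
    BdyRow d ≃ Sym2 (Fin d) ⊕ Sym2 (Fin d) ⊕ Unit ⊕ Fin d ⊕ Fin (d + 1) ⊕
      (Finset.Icc 2 ((d + 1) / 2 - 1) × Sym2 (Fin (d + 1))) where
  toFun
    | .order0 p => .inl p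
    | .order2a p => .inr (.inl p)
    | .order2bNormal => .inr (.inr (.inl ()))
    | .order2bTangential i => .inr (.inr (.inr (.inl i)))
    | .order3 α => .inr (.inr (.inr (.inr (.inl α))))
    | .orderEven l p => .inr (.inr (.inr (.inr (.inr (l, p)))))
  invFun
    | .inl p => .order0 p
    | .inr (.inl p) => .order2a p
    | .inr (.inr (.inl _)) => .order2bNormal
    | .inr (.inr (.inr (.inl i))) => .order2bTangential i
    | .inr (.inr (.inr (.inr (.inl α)))) => .order3 α
    | .inr (.inr (.inr (.inr (.inr (l, p))))) => .orderEven l p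
  left_inv r := by cases r <;> rfl
  right_inv r := by rcases r with p | p | p | p | p | ⟨l, p⟩ <;> rfl

instance (d : ℕ) : Fintype (BdyRow d) := Fintype.ofEquiv _ (BdyRow.equivSum d).symm

/-- The order of a boundary equation. -/
def BdyRow.order {d : ℕ} : BdyRow d → ℕ
  | .order0 _ => 0
  | .order2a _ => 2
  | .order2bNormal => 2
  | .order2bTangential _ => 2
  | .order3 _ => 3
  | .orderEven l _ => 2 * (l : ℕ)

/-- The highest order part of the equation `r`, with coefficients given by the metric `g`, applied
to a symmetric tensor `u`. -/
def bdyExpr {d : ℕ} (g : Matrix (Fin (d + 1)) (Fin (d + 1)) ℝ)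
    (u : Sym2 (Fin (d + 1)) → MvPolynomial (Fin (d + 1)) ℝ) :
    BdyRow d → MvPolynomial (Fin (d + 1)) ℝ
  | .order0 p => u (p.map Fin.succ)
  | .order2a p => traceOp g 1 * u (p.map Fin.succ)
  | .order2bNormal =>
      (∑ γ, ∑ η, ∑ β, C (g⁻¹ γ 0 * g⁻¹ η β) * X η * X γ * u s(0, β))
      - C (1 / 2) * ∑ γ, ∑ η, ∑ β, C (g⁻¹ γ 0 * g⁻¹ η β) * X 0 * X γ * u s(η, β)
  | .order2bTangential i =>
      C (2 * (2 - ((d : ℝ) + 1)) * (g⁻¹ 0 0) ^ 2 / (((d : ℝ) + 1) - 1)) *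
          (∑ j : Fin d, ∑ k : Fin d,
            C (g⁻¹ j.succ k.succ) * X i.succ * X j.succ * u s(0, k.succ))
      - C (g⁻¹ 0 0) *
          (∑ j : Fin d, ∑ k : Fin d,
            C (g⁻¹ j.succ k.succ) * X j.succ * X k.succ * u s(0, i.succ))
      - C ((2 - ((d : ℝ) + 1)) * (g⁻¹ 0 0) ^ 2 / (((d : ℝ) + 1) - 1)) *
          (∑ j : Fin d, ∑ k : Fin d,
            C (g⁻¹ j.succ k.succ) * X 0 * X i.succ * u s(j.succ, k.succ))
      + (∑ j : Fin d, ∑ k : Fin d,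
            C (g⁻¹ 0 j.succ * g⁻¹ 0 k.succ) * X j.succ * X k.succ * u s(0, i.succ))
      - (∑ γ, ∑ j : Fin d,
            C (g⁻¹ 0 γ * g⁻¹ 0 j.succ) * X γ * X i.succ * u s(0, j.succ))
      + (∑ γ, ∑ η, ∑ j : Fin d,
            C (g⁻¹ 0 γ * g⁻¹ η j.succ) * X η * X γ * u s(i.succ, j.succ))
      - C (1 / 2) * (∑ γ, ∑ j : Fin d, ∑ k : Fin d,
            C (g⁻¹ 0 γ * g⁻¹ j.succ k.succ) * X γ * X i.succ * u s(j.succ, k.succ))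
      - C (1 / 2) * (∑ γ, C (g⁻¹ 0 γ * g⁻¹ 0 0) * X γ * X i.succ * u s(0, 0))
  | .order3 α =>
      ∑ η, ∑ β, C (g⁻¹ η β) * X η * traceOp g 1 * u s(α, β)
  | .orderEven l p => traceOp g l * u p

/-- The matrix of the highest order parts of the boundary equations: its entry `(r, t)` is the
coefficient operator of the unknown `u^t` in the equation `r`. -/
def bdyOp {d : ℕ} (g : Matrix (Fin (d + 1)) (Fin (d + 1)) ℝ) :
    Matrix (BdyRow d) (Sym2 (Fin (d + 1))) (MvPolynomial (Fin (d + 1)) ℝ) :=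
  Matrix.of fun r t => bdyExpr g (Pi.single t 1) r

/-- The weights `w(L_s) = 0`. -/
def sysWeight (d : ℕ) : Sym2 (Fin (d + 1)) → ℤ := fun _ => 0

/-- The weights `w(u^t) = n`. -/
def unknownWeight (d : ℕ) : Sym2 (Fin (d + 1)) → ℤ := fun _ => (d : ℤ) + 1

/-- The weights `w(B_r) = s - n` of the boundary equations of order `s`. -/
def bdyWeight (d : ℕ) : BdyRow d → ℤ := fun r => (r.order : ℤ) - ((d : ℤ) + 1)

end

/-! The principal part of the system is `q ^ (n/2)` times the identity, where `q` is the quadratic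
form of the inverse metric. Hence the determinant is a power of `q`, and ellipticity is positivity
of `q`, made uniform by compactness.

On a line `ξ + τν` one has `q = (τ - z)(τ - z')` with `z`, `z'` in opposite open half planes. The
adjugate is a power of `q` and `M⁺` a power of `τ - z`. After cancellation the complementing
condition says: if every column of `∑ c_r B'_r` is divisible by `(τ - z) ^ (n/2)`, then `c = 0`.

The coefficients are eliminated by order of vanishing at `z`. In the columns `(0, α)` only the rows
of order 2(b) survive modulo `τ - z`; they form a square system, which is nonsingular by
`order2b_coeff_eq_zero`. Modulo `(τ - z)²` the rows of order 3 come next; they are `q` times a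
divergence, which is triangular on these columns with diagonal entry `ζ^0 ≠ 0`
(`coeff_order3_eq_zero`). In each column the remaining rows add up to a polynomial in `q` of degree
below `n/2`; as `z` is a simple root of `q`, its coefficients vanish (`pow_dvd_of_pow_dvd_comp`,
`coeff_power_eq_zero`). -/

/-! ### Homogeneity, principal parts and admissible weights. -/

theorem isHomogeneous_traceOp {d : ℕ} (g : Matrix (Fin (d + 1)) (Fin (d + 1)) ℝ) (l : ℕ) :
    (traceOp g l).IsHomogeneous (2 * l) := by
  unfold traceOp
  refine IsHomogeneous.pow (IsHomogeneous.sum _ _ _ fun α _ => IsHomogeneous.sum _ _ _ fun β _ => ?_) l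
  simpa using ((isHomogeneous_C _ (g⁻¹ α β)).mul (isHomogeneous_X ℝ α)).mul (isHomogeneous_X ℝ β)

/-- Products of a coefficient, two derivatives and an unknown of order zero have order two. -/
theorem isHomogeneous_two {d : ℕ} (c : ℝ) (α β : Fin (d + 1))
    {v : MvPolynomial (Fin (d + 1)) ℝ} (hv : v.IsHomogeneous 0) :
    (C c * X α * X β * v).IsHomogeneous 2 := by
  simpa using (((isHomogeneous_C _ c).mul (isHomogeneous_X ℝ α)).mul (isHomogeneous_X ℝ β)).mul hv

theorem isHomogeneous_C_mul_of {d : ℕ} (c : ℝ) {k : ℕ}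
    {v : MvPolynomial (Fin (d + 1)) ℝ} (hv : v.IsHomogeneous k) :
    (C c * v).IsHomogeneous k := by
  simpa using (isHomogeneous_C _ c).mul hv

theorem isHomogeneous_bdyExpr {d : ℕ} (g : Matrix (Fin (d + 1)) (Fin (d + 1)) ℝ)
    {u : Sym2 (Fin (d + 1)) → MvPolynomial (Fin (d + 1)) ℝ} (hu : ∀ t, (u t).IsHomogeneous 0)
    (r : BdyRow d) : (bdyExpr g u r).IsHomogeneous r.order := by
  cases r with
  | order0 p => exact hu _
  | order2a p => exact (isHomogeneous_traceOp g 1).mul (hu _)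
  | order2bNormal =>
    refine IsHomogeneous.sub ?_ (isHomogeneous_C_mul_of _ ?_) <;>
    exact IsHomogeneous.sum _ _ _ fun _ _ => IsHomogeneous.sum _ _ _ fun _ _ =>
      IsHomogeneous.sum _ _ _ fun _ _ => isHomogeneous_two _ _ _ (hu _)
  | order2bTangential i =>
    have h1 : ∀ {ι : Type} [Fintype ι] {v : ι → MvPolynomial (Fin (d + 1)) ℝ},
        (∀ i, (v i).IsHomogeneous 2) → (∑ i, v i).IsHomogeneous 2 :=
      fun h => IsHomogeneous.sum _ _ _ fun i _ => h i
    have h2 := fun (c : ℝ) (α β : Fin (d + 1)) t => isHomogeneous_two c α β (hu t)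
    refine IsHomogeneous.sub (IsHomogeneous.sub (IsHomogeneous.add (IsHomogeneous.sub
      (IsHomogeneous.add (IsHomogeneous.sub (IsHomogeneous.sub ?_ ?_) ?_) ?_) ?_) ?_) ?_) ?_
    · exact isHomogeneous_C_mul_of _ (h1 fun _ => h1 fun _ => h2 _ _ _ _)
    · exact isHomogeneous_C_mul_of _ (h1 fun _ => h1 fun _ => h2 _ _ _ _)
    · exact isHomogeneous_C_mul_of _ (h1 fun _ => h1 fun _ => h2 _ _ _ _)
    · exact h1 fun _ => h1 fun _ => h2 _ _ _ _
    · exact h1 fun _ => h1 fun _ => h2 _ _ _ _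
    · exact h1 fun _ => h1 fun _ => h1 fun _ => h2 _ _ _ _
    · exact isHomogeneous_C_mul_of _ (h1 fun _ => h1 fun _ => h1 fun _ => h2 _ _ _ _)
    · exact isHomogeneous_C_mul_of _ (h1 fun _ => h2 _ _ _ _)
  | order3 α =>
    refine IsHomogeneous.sum _ _ _ fun η _ => IsHomogeneous.sum _ _ _ fun β _ => ?_
    exact (((isHomogeneous_C _ (g⁻¹ η β)).mul (isHomogeneous_X ℝ η)).mul
      (isHomogeneous_traceOp g 1)).mul (hu _)
  | orderEven l p => exact (isHomogeneous_traceOp g l).mul (hu _)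

theorem isHomogeneous_bdyOp {d : ℕ} (g : Matrix (Fin (d + 1)) (Fin (d + 1)) ℝ)
    (r : BdyRow d) (t : Sym2 (Fin (d + 1))) : (bdyOp g r t).IsHomogeneous r.order := by
  refine isHomogeneous_bdyExpr g (fun s => ?_) r
  rw [Pi.single_apply]
  split_ifs
  · exact isHomogeneous_one _ _
  · exact isHomogeneous_zero _ _ _

theorem isHomogeneous_systemOp {d : ℕ} (heven : Even (d + 1))
    (g : Matrix (Fin (d + 1)) (Fin (d + 1)) ℝ)
    (s t : Sym2 (Fin (d + 1))) : (systemOp g s t).IsHomogeneous (d + 1) := by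
  rw [systemOp, Matrix.diagonal_apply]
  split_ifs
  · simpa [Nat.two_mul_div_two_of_even heven] using isHomogeneous_traceOp g ((d + 1) / 2)
  · exact isHomogeneous_zero _ _ _

theorem orderLE_of_orderLT_sub {d k : ℕ} {p q : MvPolynomial (Fin (d + 1)) ℝ}
    (hq : q.IsHomogeneous k) (h : OrderLT (p - q) k) : OrderLE p k := by
  intro m hm
  by_cases hmq : coeff m q = 0
  · have : m ∈ (p - q).support := by
      simpa [hmq] using hm
    exact_mod_cast (h m this).le
  · exact_mod_cast (hq.degree_eq_sum_deg_support (mem_support_iff.2 hmq)).symm.le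

theorem orderPart_of_orderLT_sub {d k : ℕ} {p q : MvPolynomial (Fin (d + 1)) ℝ}
    (hq : q.IsHomogeneous k) (h : OrderLT (p - q) k) : orderPart k p = q := by
  have h0 : homogeneousComponent k (p - q) = 0 := by
    refine homogeneousComponent_eq_zero' _ _ fun m hm => (h m hm).ne
  rw [map_sub, sub_eq_zero, homogeneousComponent_of_mem ((mem_homogeneousSubmodule _ _).2 hq),
    if_pos rfl] at h0
  simp [orderPart, h0]

theorem principalPart_system {d : ℕ} (heven : Even (d + 1))
    {g : Matrix (Fin (d + 1)) (Fin (d + 1)) ℝ}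
    {L : Matrix (Sym2 (Fin (d + 1))) (Sym2 (Fin (d + 1))) (MvPolynomial (Fin (d + 1)) ℝ)}
    (hL : ∀ s t, OrderLT (L s t - systemOp g s t) (d + 1)) :
    principalPart (sysWeight d) (unknownWeight d) L = systemOp g := by
  ext1 s t
  have := orderPart_of_orderLT_sub (isHomogeneous_systemOp heven g s t) (hL s t)
  simpa [principalPart, sysWeight, unknownWeight] using this

theorem principalPart_bdy {d : ℕ} {g : Matrix (Fin (d + 1)) (Fin (d + 1)) ℝ}
    {B : Matrix (BdyRow d) (Sym2 (Fin (d + 1))) (MvPolynomial (Fin (d + 1)) ℝ)}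
    (hB : ∀ r t, OrderLT (B r t - bdyOp g r t) r.order) :
    principalPart (bdyWeight d) (unknownWeight d) B = bdyOp g := by
  ext1 r t
  have := orderPart_of_orderLT_sub (isHomogeneous_bdyOp g r t) (hB r t)
  simpa [principalPart, bdyWeight, unknownWeight] using this

theorem admissibleWeights_of_orderLT {d : ℕ} (heven : Even (d + 1))
    {U : Set (Fin (d + 1) → ℝ)} {g : (Fin (d + 1) → ℝ) → Matrix (Fin (d + 1)) (Fin (d + 1)) ℝ}
    {L : (Fin (d + 1) → ℝ) →
      Matrix (Sym2 (Fin (d + 1))) (Sym2 (Fin (d + 1))) (MvPolynomial (Fin (d + 1)) ℝ)}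
    {B : (Fin (d + 1) → ℝ) →
      Matrix (BdyRow d) (Sym2 (Fin (d + 1))) (MvPolynomial (Fin (d + 1)) ℝ)}
    (hL : ∀ x ∈ U, ∀ s t, OrderLT (L x s t - systemOp (g x) s t) (d + 1))
    (hB : ∀ x ∈ boundaryPortion U, ∀ r t, OrderLT (B x r t - bdyOp (g x) r t) r.order) :
    AdmissibleWeights U (boundaryPortion U) L B (sysWeight d) (unknownWeight d) (bdyWeight d) := by
  refine ⟨fun x hx s t => ?_, fun x hx r t => ?_, fun s => le_rfl, s(0, 0), rfl⟩
  · simpa [sysWeight, unknownWeight] using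
      orderLE_of_orderLT_sub (isHomogeneous_systemOp heven (g x) s t) (hL x hx s t)
  · simpa [bdyWeight, unknownWeight] using
      orderLE_of_orderLT_sub (isHomogeneous_bdyOp (g x) r t) (hB x hx r t)

/-! ### The determinant of the system and the number of boundary equations. -/

/-- The quadratic form `g^{αβ} ξ_α ξ_β`. -/
theorem eval_traceOp_one {d : ℕ} (g : Matrix (Fin (d + 1)) (Fin (d + 1)) ℝ)
    (ξ : Fin (d + 1) → ℝ) :
    eval ξ (traceOp g 1) = ∑ α, ∑ β, g⁻¹ α β * ξ α * ξ β := by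
  simp [traceOp]

theorem eval_traceOp_one_pos {d : ℕ} {g : Matrix (Fin (d + 1)) (Fin (d + 1)) ℝ} (hg : g.PosDef)
    {ξ : Fin (d + 1) → ℝ} (hξ : ξ ≠ 0) : 0 < eval ξ (traceOp g 1) := by
  have := hg.inv.dotProduct_mulVec_pos hξ
  rw [eval_traceOp_one]
  simp only [dotProduct, Matrix.mulVec, Finset.mul_sum, Pi.star_apply, star_trivial] at this
  refine this.trans_eq (Finset.sum_congr rfl fun α _ => Finset.sum_congr rfl fun β _ => ?_)
  ring

theorem traceOp_eq_pow {d : ℕ} (g : Matrix (Fin (d + 1)) (Fin (d + 1)) ℝ) (l : ℕ) :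
    traceOp g l = traceOp g 1 ^ l := by
  simp [traceOp]

theorem det_systemOp {d : ℕ} (g : Matrix (Fin (d + 1)) (Fin (d + 1)) ℝ) :
    (systemOp g).det = traceOp g 1 ^ ((d + 1) / 2 * Fintype.card (Sym2 (Fin (d + 1)))) := by
  rw [systemOp, Matrix.det_diagonal, Finset.prod_const, traceOp_eq_pow g ((d + 1) / 2), ← pow_mul]
  rfl

theorem totalDegree_det_systemOp {d : ℕ} {g : Matrix (Fin (d + 1)) (Fin (d + 1)) ℝ}
    (hg : g.PosDef) :
    (systemOp g).det.totalDegree =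
      2 * ((d + 1) / 2 * Fintype.card (Sym2 (Fin (d + 1)))) := by
  have h0 : traceOp g 1 ≠ 0 := by
    intro h
    have := eval_traceOp_one_pos hg (ξ := fun _ => 1) (fun h => one_ne_zero (congrFun h 0))
    simp [h] at this
  rw [det_systemOp, ((isHomogeneous_traceOp g 1).pow _).totalDegree (pow_ne_zero _ h0)]

/-- With `N` unknowns, orders 0 and 2(a) have `N - n` rows each, and orders 2(b) and 3 have `n`
each, `2N` together. The even orders from 4 on add `(n/2 - 2) N`. -/
theorem card_bdyRow {d : ℕ} (hn : 4 ≤ d + 1) (heven : Even (d + 1)) :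
    Fintype.card (BdyRow d) = (d + 1) / 2 * Fintype.card (Sym2 (Fin (d + 1))) := by
  rw [Fintype.card_congr (BdyRow.equivSum d)]
  obtain ⟨k, hk⟩ := heven
  have hk2 : 2 ≤ k := by omega
  obtain ⟨k, rfl⟩ := Nat.exists_eq_add_of_le hk2
  have hdiv : (d + 1) / 2 = 2 + k := by omega
  have hs : Fintype.card (Sym2 (Fin d)) + (d + 1) = Fintype.card (Sym2 (Fin (d + 1))) := by
    rw [Sym2.card, Sym2.card, Fintype.card_fin, Fintype.card_fin, Nat.choose_succ_succ' (d + 1) 1,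
      Nat.choose_one_right, add_comm]
  have hI : Fintype.card (Finset.Icc 2 ((d + 1) / 2 - 1)) = k := by
    rw [Fintype.card_coe, Nat.card_Icc]; omega
  simp only [Fintype.card_sum, Fintype.card_prod, Fintype.card_unit, Fintype.card_fin, hI]
  rw [hdiv, ← hs]
  ring

/-! ### Uniform ellipticity. -/

theorem continuousOn_eval_traceOp {d : ℕ} {U : Set (Fin (d + 1) → ℝ)}
    {g : (Fin (d + 1) → ℝ) → Matrix (Fin (d + 1)) (Fin (d + 1)) ℝ}
    (hg : ContinuousOn g U) (hpos : ∀ x ∈ U, (g x).PosDef) :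
    ContinuousOn (fun y : (Fin (d + 1) → ℝ) × EuclideanSpace ℝ (Fin (d + 1)) =>
      eval y.2.ofLp (traceOp (g y.1) 1)) (U ×ˢ Set.univ) := by
  have hinv : ∀ α β, ContinuousOn (fun x => (g x)⁻¹ α β) U := by
    intro α β
    have hdet : ContinuousOn (fun x => (g x).det) U :=
      (continuous_id.matrix_det).comp_continuousOn hg
    have hadj : ContinuousOn (fun x => (g x).adjugate α β) U :=
      ((continuous_id.matrix_adjugate).matrix_elem α β).comp_continuousOn hg
    refine ((hdet.inv₀ fun x hx => (hpos x hx).det_pos.ne').mul hadj).congr fun x _ => ?_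
    simp [Matrix.inv_def]
  simp only [eval_traceOp_one]
  refine continuousOn_finsetSum _ fun α _ => continuousOn_finsetSum _ fun β _ => ?_
  refine (((hinv α β).comp continuousOn_fst fun y hy => hy.1).mul ?_).mul ?_ <;>
  exact Continuous.continuousOn (by fun_prop)

/-- The form is continuous and positive on the compact product of `K` with the unit sphere, so it
and its reciprocal are bounded there; homogeneity of degree two extends the bounds to all covectors.
-/
theorem exists_traceOp_bounds {d : ℕ} {U K : Set (Fin (d + 1) → ℝ)} (hKU : K ⊆ U)
    (hK : IsCompact K) {g : (Fin (d + 1) → ℝ) → Matrix (Fin (d + 1)) (Fin (d + 1)) ℝ}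
    (hg : ContinuousOn g U) (hpos : ∀ x ∈ U, (g x).PosDef) :
    ∃ b : ℝ, 0 < b ∧ ∀ x ∈ K, ∀ ξ : Fin (d + 1) → ℝ,
      b⁻¹ * ‖WithLp.toLp 2 ξ‖ ^ 2 ≤ eval ξ (traceOp (g x) 1) ∧
      eval ξ (traceOp (g x) 1) ≤ b * ‖WithLp.toLp 2 ξ‖ ^ 2 := by
  set S := K ×ˢ Metric.sphere (0 : EuclideanSpace ℝ (Fin (d + 1))) 1 with hS
  have hSc : IsCompact S := hK.prod (isCompact_sphere _ _)
  have hF := (continuousOn_eval_traceOp hg hpos).mono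
    (show S ⊆ U ×ˢ Set.univ from Set.prod_mono hKU (Set.subset_univ _))
  have hFpos : ∀ y ∈ S, 0 < eval y.2.ofLp (traceOp (g y.1) 1) := by
    rintro ⟨x, v⟩ ⟨hx, hv⟩
    refine eval_traceOp_one_pos (hpos x (hKU hx)) fun h => ?_
    have hv0 : v = 0 := by ext i; exact congrFun h i
    simp [hv0] at hv
  obtain ⟨b₁, hb₁⟩ := hSc.exists_bound_of_continuousOn hF
  obtain ⟨b₂, hb₂⟩ := hSc.exists_bound_of_continuousOn (f := fun y =>
    (eval y.2.ofLp (traceOp (g y.1) 1))⁻¹) (hF.inv₀ fun y hy => (hFpos y hy).ne')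
  -- The entry `1` only serves to make the constant positive, also when `K` is empty.
  have hb : 0 < max 1 (max b₁ b₂) := lt_max_of_lt_left one_pos
  refine ⟨max 1 (max b₁ b₂), hb, fun x hx ξ => ?_⟩
  rcases eq_or_ne ξ 0 with rfl | hξ
  · rw [eval_traceOp_one]
    simp
  have hr : 0 < ‖WithLp.toLp 2 ξ‖ := norm_pos_iff.2 fun h => hξ (by simpa using h)
  set r := ‖WithLp.toLp 2 ξ‖ with hr_def
  have hy : (x, r⁻¹ • WithLp.toLp 2 ξ) ∈ S := by
    refine ⟨hx, ?_⟩
    simp [norm_smul, ← hr_def, abs_of_pos hr, hr.ne']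
  have hscale : eval ξ (traceOp (g x) 1) =
      eval (r⁻¹ • WithLp.toLp 2 ξ).ofLp (traceOp (g x) 1) * r ^ 2 := by
    simp only [eval_traceOp_one, Finset.sum_mul]
    refine Finset.sum_congr rfl fun α _ => Finset.sum_congr rfl fun β _ => ?_
    simp only [WithLp.ofLp_smul, Pi.smul_apply, smul_eq_mul]
    field_simp
  have h0 := hFpos _ hy
  have h1 := hb₁ _ hy
  have h2 := hb₂ _ hy
  simp only [norm_inv, Real.norm_of_nonneg h0.le] at h0 h1 h2
  rw [hscale]
  constructor
  · gcongr
    rw [inv_le_comm₀ hb h0]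
    exact h2.trans ((le_max_right _ _).trans (le_max_right _ _))
  · gcongr
    exact h1.trans ((le_max_left _ _).trans (le_max_right _ _))

theorem uniformlyEllipticOn_systemOp {d : ℕ} {U K : Set (Fin (d + 1) → ℝ)} (hKU : K ⊆ U)
    (hK : IsCompact K) {g : (Fin (d + 1) → ℝ) → Matrix (Fin (d + 1)) (Fin (d + 1)) ℝ}
    (hg : ContinuousOn g U) (hpos : ∀ x ∈ U, (g x).PosDef) :
    UniformlyEllipticOn K fun x => systemOp (g x) := by
  obtain ⟨b, hb, h⟩ := exists_traceOp_bounds hKU hK hg hpos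
  refine ⟨b ^ ((d + 1) / 2 * Fintype.card (Sym2 (Fin (d + 1)))), pow_pos hb _, fun x hx ξ => ?_⟩
  obtain ⟨h1, h2⟩ := h x hx ξ
  have h0 : 0 ≤ eval ξ (traceOp (g x) 1) := le_trans (by positivity) h1
  rw [totalDegree_det_systemOp (hpos x (hKU hx)), det_systemOp, map_pow,
    abs_of_nonneg (pow_nonneg h0 _), pow_mul ‖_‖, ← inv_pow, ← mul_pow, ← mul_pow]
  exact ⟨pow_le_pow_left₀ (by positivity) h1 _, pow_le_pow_left₀ h0 h2 _⟩

/-! ### Boundary symbols in the columns `(0, α)`. -/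

/-- The covector `ζ` with its index raised by the metric: `g^{ηβ} ζ_η`. -/
noncomputable def raiseIndex {d : ℕ} (g : Matrix (Fin (d + 1)) (Fin (d + 1)) ℝ)
    (ζ : Fin (d + 1) → ℂ) (β : Fin (d + 1)) : ℂ :=
  ∑ η, (g⁻¹ η β : ℂ) * ζ η

theorem aeval_single {d : ℕ} (ζ : Fin (d + 1) → ℂ) (s t : Sym2 (Fin (d + 1))) :
    aeval ζ ((Pi.single t 1 : Sym2 (Fin (d + 1)) → MvPolynomial (Fin (d + 1)) ℝ) s) =
      if s = t then 1 else 0 := by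
  rw [Pi.single_apply]; split_ifs <;> simp

theorem aeval_traceOp_one {d : ℕ} (g : Matrix (Fin (d + 1)) (Fin (d + 1)) ℝ)
    (ζ : Fin (d + 1) → ℂ) :
    aeval ζ (traceOp g 1) = ∑ β, raiseIndex g ζ β * ζ β := by
  simp only [traceOp, pow_one, map_sum, map_mul, aeval_C, aeval_X, raiseIndex, Finset.sum_mul]
  rw [Finset.sum_comm]
  rfl

theorem raiseIndex_zero_eq {d : ℕ} {g : Matrix (Fin (d + 1)) (Fin (d + 1)) ℝ} (hg : g⁻¹.IsSymm)
    (ζ : Fin (d + 1) → ℂ) :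
    raiseIndex g ζ 0 = g⁻¹ 0 0 * ζ 0 + ∑ j : Fin d, (g⁻¹ 0 j.succ : ℂ) * ζ j.succ := by
  rw [raiseIndex, Fin.sum_univ_succ]
  simp only [fun j : Fin d => hg.apply 0 j.succ]

/-- The part of the quadratic form of the metric which is normal to the boundary: completing the
square in `ζ_0`. -/
theorem raiseIndex_zero_sq {d : ℕ} {g : Matrix (Fin (d + 1)) (Fin (d + 1)) ℝ} (hg : g⁻¹.IsSymm)
    (ζ : Fin (d + 1) → ℂ) :
    raiseIndex g ζ 0 ^ 2 = g⁻¹ 0 0 * aeval ζ (traceOp g 1) -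
      (g⁻¹ 0 0 * (∑ k : Fin d, (∑ j : Fin d, (g⁻¹ j.succ k.succ : ℂ) * ζ j.succ) * ζ k.succ) -
        (∑ j : Fin d, (g⁻¹ 0 j.succ : ℂ) * ζ j.succ) ^ 2) := by
  have h1 : ∑ k : Fin d, raiseIndex g ζ k.succ * ζ k.succ =
      ζ 0 * (∑ j : Fin d, (g⁻¹ 0 j.succ : ℂ) * ζ j.succ) +
      ∑ k : Fin d, (∑ j : Fin d, (g⁻¹ j.succ k.succ : ℂ) * ζ j.succ) * ζ k.succ := by
    rw [Finset.mul_sum, ← Finset.sum_add_distrib]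
    refine Finset.sum_congr rfl fun k _ => ?_
    rw [raiseIndex, Fin.sum_univ_succ]
    ring
  rw [aeval_traceOp_one, Fin.sum_univ_succ, h1, raiseIndex_zero_eq hg]
  ring

theorem aeval_order2bNormal_zero {d : ℕ} (g : Matrix (Fin (d + 1)) (Fin (d + 1)) ℝ)
    (ζ : Fin (d + 1) → ℂ) :
    aeval ζ (bdyOp g .order2bNormal s(0, 0)) =
      raiseIndex g ζ 0 * (raiseIndex g ζ 0 - 1 / 2 * ζ 0 * g⁻¹ 0 0) := by
  simp only [bdyOp, bdyExpr, Matrix.of_apply, map_sub, map_sum, map_mul, aeval_single, aeval_C,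
    aeval_X]
  have h : ∀ η β : Fin (d + 1), s(η, β) = s((0 : Fin (d + 1)), 0) ↔ β = 0 ∧ η = 0 := by
    intro η β; simp [and_comm]
  simp only [h, ite_and, mul_ite, mul_one, mul_zero, Finset.sum_ite_eq',
    Finset.mem_univ, if_true, raiseIndex, mul_sub, Finset.sum_mul, Finset.mul_sum]
  congr 1
  · rw [Finset.sum_comm]
    simp
    refine Finset.sum_congr rfl fun γ _ => Finset.sum_congr rfl fun η _ => ?_
    ring
  · simp
    refine Finset.sum_congr rfl fun γ _ => ?_
    ring

/-- The trace term meets the unordered pair twice, which cancels its factor `1/2`; what it subtracts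
is the `ζ_0` part of the raised index, so only tangential components remain. -/
theorem aeval_order2bNormal_succ {d : ℕ} {g : Matrix (Fin (d + 1)) (Fin (d + 1)) ℝ}
    (hg : g⁻¹.IsSymm) (ζ : Fin (d + 1) → ℂ) (k : Fin d) :
    aeval ζ (bdyOp g .order2bNormal s(0, k.succ)) =
      raiseIndex g ζ 0 * ∑ j : Fin d, (g⁻¹ j.succ k.succ : ℂ) * ζ j.succ := by
  have h1 : ∑ γ, ∑ η, (g⁻¹ γ 0 : ℂ) * g⁻¹ η k.succ * ζ η * ζ γ =
      raiseIndex g ζ 0 * raiseIndex g ζ k.succ := by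
    simp only [raiseIndex, Finset.sum_mul_sum]
    refine Finset.sum_congr rfl fun γ _ => Finset.sum_congr rfl fun η _ => ?_
    ring
  have h2 : ∑ γ, ((g⁻¹ γ 0 : ℂ) * g⁻¹ 0 k.succ * ζ 0 * ζ γ + g⁻¹ γ 0 * g⁻¹ k.succ 0 * ζ 0 * ζ γ) =
      raiseIndex g ζ 0 * (2 * ζ 0 * g⁻¹ 0 k.succ) := by
    simp only [raiseIndex, Finset.sum_mul]
    refine Finset.sum_congr rfl fun γ _ => ?_
    rw [hg.apply 0 k.succ]
    ring
  have h3 : raiseIndex g ζ k.succ =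
      g⁻¹ 0 k.succ * ζ 0 + ∑ j : Fin d, (g⁻¹ j.succ k.succ : ℂ) * ζ j.succ := by
    rw [raiseIndex, Fin.sum_univ_succ]
  simp only [bdyOp, bdyExpr, Matrix.of_apply, map_sub, map_sum, map_mul, aeval_single, aeval_C,
    aeval_X]
  -- The two orderings of the pair are disjoint cases because `0` is not a successor.
  have h : ∀ (η β : Fin (d + 1)) (x : ℂ),
      (x * if s(η, β) = s((0 : Fin (d + 1)), k.succ) then 1 else 0) =
      (if η = 0 then (if β = k.succ then x else 0) else 0) +
        (if η = k.succ then (if β = 0 then x else 0) else 0) := by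
    intro η β x
    by_cases h1 : η = 0 <;> by_cases h2 : β = 0 <;> by_cases h3 : η = k.succ <;>
      by_cases h4 : β = k.succ <;>
      simp_all [Fin.succ_ne_zero, (Fin.succ_ne_zero _).symm]
  simp only [h, Finset.sum_add_distrib]
  simp [(Fin.succ_ne_zero k).symm]
  rw [← Finset.sum_add_distrib, h1, h2, h3]
  ring

theorem aeval_order2bTangential_zero {d : ℕ} {g : Matrix (Fin (d + 1)) (Fin (d + 1)) ℝ}
    (hg : g⁻¹.IsSymm) (ζ : Fin (d + 1) → ℂ) (i : Fin d) :
    aeval ζ (bdyOp g (.order2bTangential i) s(0, 0)) =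
      -(1 / 2) * raiseIndex g ζ 0 * ζ i.succ * g⁻¹ 0 0 := by
  simp only [bdyOp, bdyExpr, Matrix.of_apply, map_sub, map_add, map_sum, map_mul, aeval_single,
    aeval_C, aeval_X]
  simp [raiseIndex, Finset.sum_mul, Finset.mul_sum]
  refine Finset.sum_congr rfl fun γ _ => ?_
  rw [hg.apply γ 0]
  ring

/-- The diagonal term is the expression that completes the square in `raiseIndex_zero_sq`; at a root
of `q` it equals `-(ζ^0)²`. -/
theorem aeval_order2bTangential_succ {d : ℕ} {g : Matrix (Fin (d + 1)) (Fin (d + 1)) ℝ}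
    (hg : g⁻¹.IsSymm) (ζ : Fin (d + 1) → ℂ) (i k : Fin d) :
    aeval ζ (bdyOp g (.order2bTangential i) s(0, k.succ)) =
      2 * ((1 - d) * (g⁻¹ 0 0) ^ 2 / d) * ζ i.succ *
          (∑ j : Fin d, (g⁻¹ j.succ k.succ : ℂ) * ζ j.succ)
        - (if i = k then
            g⁻¹ 0 0 * (∑ k : Fin d, (∑ j : Fin d, (g⁻¹ j.succ k.succ : ℂ) * ζ j.succ) * ζ k.succ) -
            (∑ j : Fin d, (g⁻¹ 0 j.succ : ℂ) * ζ j.succ) ^ 2 else 0)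
        - raiseIndex g ζ 0 * ζ i.succ * g⁻¹ 0 k.succ := by
  have h1 : ∑ j : Fin d, (g⁻¹ j.succ k.succ : ℂ) * ζ i.succ * ζ j.succ =
      ζ i.succ * ∑ j : Fin d, (g⁻¹ j.succ k.succ : ℂ) * ζ j.succ := by
    rw [Finset.mul_sum]
    exact Finset.sum_congr rfl fun j _ => by ring
  have h2 : ∑ j : Fin d, ∑ k : Fin d, (g⁻¹ j.succ k.succ : ℂ) * ζ j.succ * ζ k.succ =
      ∑ k : Fin d, (∑ j : Fin d, (g⁻¹ j.succ k.succ : ℂ) * ζ j.succ) * ζ k.succ := by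
    rw [Finset.sum_comm]
    simp only [Finset.sum_mul]
  have h3 : ∑ j : Fin d, ∑ k : Fin d, (g⁻¹ 0 j.succ : ℂ) * g⁻¹ 0 k.succ * ζ j.succ * ζ k.succ =
      (∑ j : Fin d, (g⁻¹ 0 j.succ : ℂ) * ζ j.succ) ^ 2 := by
    rw [sq, Finset.sum_mul_sum]
    exact Finset.sum_congr rfl fun j _ => Finset.sum_congr rfl fun k _ => by ring
  have h4 : ∑ γ, (g⁻¹ 0 γ : ℂ) * g⁻¹ 0 k.succ * ζ γ * ζ i.succ =
      raiseIndex g ζ 0 * ζ i.succ * g⁻¹ 0 k.succ := by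
    simp only [raiseIndex, Finset.sum_mul]
    refine Finset.sum_congr rfl fun γ _ => ?_
    rw [hg.apply 0 γ]
    ring
  simp only [bdyOp, bdyExpr, Matrix.of_apply, map_sub, map_add, map_sum, map_mul, aeval_single,
    aeval_C, aeval_X]
  simp [(Fin.succ_ne_zero k).symm]
  rw [h1, h2, h3, h4]
  split_ifs <;> ring

theorem bdyOp_order3 {d : ℕ} (g : Matrix (Fin (d + 1)) (Fin (d + 1)) ℝ) (α : Fin (d + 1))
    (t : Sym2 (Fin (d + 1))) :
    bdyOp g (.order3 α) t = traceOp g 1 * ∑ η, ∑ β, C (g⁻¹ η β) * X η *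
      (Pi.single t 1 : Sym2 (Fin (d + 1)) → MvPolynomial (Fin (d + 1)) ℝ) s(α, β) := by
  simp only [bdyOp, bdyExpr, Matrix.of_apply, Finset.mul_sum]
  exact Finset.sum_congr rfl fun η _ => Finset.sum_congr rfl fun β _ => by ring

theorem aeval_divergence_zero {d : ℕ} (g : Matrix (Fin (d + 1)) (Fin (d + 1)) ℝ)
    (ζ : Fin (d + 1) → ℂ) (α : Fin (d + 1)) :
    aeval ζ (∑ η, ∑ β, C (g⁻¹ η β) * X η *
      (Pi.single s(0, 0) 1 : Sym2 (Fin (d + 1)) → MvPolynomial (Fin (d + 1)) ℝ) s(α, β)) =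
      if α = 0 then raiseIndex g ζ 0 else 0 := by
  simp only [map_sum, map_mul, aeval_single, aeval_C, aeval_X]
  by_cases h : α = 0 <;> simp [h, raiseIndex]

theorem aeval_divergence_succ {d : ℕ} (g : Matrix (Fin (d + 1)) (Fin (d + 1)) ℝ)
    (ζ : Fin (d + 1) → ℂ) (j k : Fin d) :
    aeval ζ (∑ η, ∑ β, C (g⁻¹ η β) * X η *
      (Pi.single s(0, k.succ) 1 : Sym2 (Fin (d + 1)) → MvPolynomial (Fin (d + 1)) ℝ)
        s(j.succ, β)) =
      if j = k then raiseIndex g ζ 0 else 0 := by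
  simp only [map_sum, map_mul, aeval_single, aeval_C, aeval_X]
  by_cases h : j = k <;> simp [h, raiseIndex]

/-! ### Two algebraic lemmas: the order 2(b) system and composition with a simple root. -/

/-- The linear system satisfied by the coefficients of the equations of order 2(b) has only the
zero solution. -/
theorem order2b_coeff_eq_zero {d : ℕ} {a κ e y b s z : ℂ} {f x v w : Fin d → ℂ}
    (hκ : κ ≠ 0) (hy : y = a * z + b) (hb : b = ∑ j, v j * x j)
    (hs : s = a * (∑ k, w k * x k) - b ^ 2) (hys : y ^ 2 = -s)
    (hy0 : y ≠ 0) (hyb : y + b ≠ 0) (hyb' : b - y ≠ 0)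
    (h1 : e * (y * (y - 1 / 2 * z * a)) + ∑ i, f i * (-(1 / 2) * y * x i * a) = 0)
    (h2 : ∀ k, e * (y * w k) +
      ∑ i, f i * (2 * κ * x i * w k - (if i = k then s else 0) - y * x i * v k) = 0) :
    e = 0 ∧ ∀ k, f k = 0 := by
  set F := ∑ i, f i * x i with hF
  -- Column `(0, 0)`, divided by `y / 2`: since `a z = y - b`, the factor `2y - a z` is `y + b`.
  have h1' : e * (y + b) = a * F := by
    have : ∑ i, f i * (-(1 / 2) * y * x i * a) = -(1 / 2) * y * a * F := by
      rw [hF, Finset.mul_sum]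
      exact Finset.sum_congr rfl fun i _ => by ring
    rw [this] at h1
    refine mul_left_cancel₀ hy0 ?_
    linear_combination 2 * h1 - e * y * hy
  have h2' : ∀ k, (e * y + 2 * κ * F) * w k - s * f k - y * F * v k = 0 := by
    intro k
    have : ∑ i, f i * (2 * κ * x i * w k - (if i = k then s else 0) - y * x i * v k) =
        2 * κ * F * w k - s * f k - y * F * v k := by
      simp only [mul_sub, Finset.sum_sub_distrib, mul_ite, mul_zero, Finset.sum_ite_eq',
        Finset.mem_univ, if_true, hF, Finset.mul_sum, Finset.sum_mul]
      congr 1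
      · congr 1
        · exact Finset.sum_congr rfl fun i _ => by ring
        · ring
      · exact Finset.sum_congr rfl fun i _ => by ring
    linear_combination h2 k - this
  -- Contracting the columns `(0, k)` with `x_k` leaves two scalar unknowns, `e` and `F`.
  have h3 : (e * y + 2 * κ * F) * (∑ k, w k * x k) - s * F - y * F * b = 0 := by
    have : ∑ k, ((e * y + 2 * κ * F) * (w k * x k) - s * (f k * x k) - y * F * (v k * x k)) = 0 :=
      Finset.sum_eq_zero fun k _ => by linear_combination x k * h2' k
    simpa only [Finset.sum_sub_distrib, ← Finset.mul_sum, ← hF, ← hb] using this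
  have hF0 : F = 0 := by
    -- Multiply by `a` and insert `a W = s + b²`, `s = -y²` and `a F = e (y + b)`. All terms in `e`
    -- cancel, and only the `κ` term is left, so `κ ≠ 0` is what determines `F`.
    have h4 : (2 * κ * ((b - y) * (y + b))) * F = 0 := by
      generalize (∑ k, w k * x k) = W at *
      linear_combination a * h3 + (y * b - y ^ 2) * (-h1') + (e * y + 2 * κ * F) * (hs - hys)
        + a * F * hys
    exact (mul_eq_zero.1 h4).resolve_left
      (mul_ne_zero (mul_ne_zero two_ne_zero hκ) (mul_ne_zero hyb' hyb))
  have he : e = 0 := by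
    rw [hF0, mul_zero] at h1'
    exact (mul_eq_zero.1 h1').resolve_right hyb
  refine ⟨he, fun k => ?_⟩
  have h5 := h2' k
  have hs0 : s ≠ 0 := fun h => hy0 (by simpa [h] using hys)
  rw [he, hF0] at h5
  simpa [hs0] using h5

/-- Evaluation at `z` gives `P(0) = 0`. Writing `P = X Q`, one factor `X - z` cancels, and the
cofactor `p₁` is coprime to `X - z`, so induction applies to `Q`. -/
theorem pow_dvd_of_pow_dvd_comp {z : ℂ} {p p₁ : Polynomial ℂ}
    (hp : p = (Polynomial.X - Polynomial.C z) * p₁) (hp₁ : p₁.eval z ≠ 0) (k : ℕ)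
    (P : Polynomial ℂ) (h : (Polynomial.X - Polynomial.C z) ^ k ∣ P.comp p) :
    Polynomial.X ^ k ∣ P := by
  induction k generalizing P with
  | zero => simp
  | succ k ih =>
    have hP0 : P.eval 0 = 0 := by
      have := Polynomial.dvd_iff_isRoot.1 ((dvd_pow_self _ k.succ_ne_zero).trans h)
      simpa [Polynomial.IsRoot, Polynomial.eval_comp, hp] using this
    obtain ⟨Q, rfl⟩ : Polynomial.X ∣ P := by
      rw [Polynomial.X_dvd_iff, Polynomial.coeff_zero_eq_eval_zero, hP0]
    rw [pow_succ']
    refine mul_dvd_mul_left _ (ih Q ?_)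
    rw [Polynomial.mul_comp, Polynomial.X_comp, hp, pow_succ', mul_assoc,
      mul_dvd_mul_iff_left (Polynomial.X_sub_C_ne_zero z), ← hp] at h
    refine IsCoprime.dvd_of_dvd_mul_left (IsCoprime.pow_left ?_) h
    refine (Polynomial.irreducible_X_sub_C z).coprime_iff_not_dvd.2 fun h => hp₁ ?_
    exact Polynomial.dvd_iff_isRoot.1 h

theorem BdyRow.sum_eq {d : ℕ} {M : Type*} [AddCommMonoid M] (F : BdyRow d → M) :
    ∑ r, F r = (∑ p, F (.order0 p)) + ((∑ p, F (.order2a p)) + (F .order2bNormal +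
      ((∑ i, F (.order2bTangential i)) + ((∑ α, F (.order3 α)) +
        ∑ l, ∑ p, F (.orderEven l p))))) := by
  rw [← (BdyRow.equivSum d).symm.sum_comp]
  simp only [Fintype.sum_sum_type, Fintype.sum_prod_type, Finset.univ_unique, Finset.sum_singleton]
  rfl

/-! ### Elimination of the coefficients by order of vanishing at `z`. -/

/-- Restriction of symbols to the line `ξ + τ ν`. -/
noncomputable def alongHom {d : ℕ} (ξ ν : Fin (d + 1) → ℝ) :
    MvPolynomial (Fin (d + 1)) ℝ →ₐ[ℝ] Polynomial ℂ :=
  aeval fun α => Polynomial.C (ξ α : ℂ) + Polynomial.C (ν α : ℂ) * (Polynomial.X : Polynomial ℂ)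

theorem eval_alongHom {d : ℕ} (ξ ν : Fin (d + 1) → ℝ) (z : ℂ)
    (P : MvPolynomial (Fin (d + 1)) ℝ) :
    (alongHom ξ ν P).eval z = aeval (fun α => (ξ α + ν α * z : ℂ)) P := by
  unfold alongHom
  induction P using MvPolynomial.induction_on with
  | C a => simp [Polynomial.algebraMap_apply]
  | add p q hp hq => simp only [map_add, Polynomial.eval_add, hp, hq]
  | mul_X p i hp => simp only [map_mul, Polynomial.eval_mul, hp, aeval_X]; simp

theorem bdyOp_order0 {d : ℕ} (g : Matrix (Fin (d + 1)) (Fin (d + 1)) ℝ) (p : Sym2 (Fin d))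
    (t : Sym2 (Fin (d + 1))) :
    bdyOp g (.order0 p) t = if p.map Fin.succ = t then 1 else 0 := by
  simp [bdyOp, bdyExpr, Pi.single_apply]

theorem bdyOp_order2a {d : ℕ} (g : Matrix (Fin (d + 1)) (Fin (d + 1)) ℝ) (p : Sym2 (Fin d))
    (t : Sym2 (Fin (d + 1))) :
    bdyOp g (.order2a p) t = traceOp g 1 * if p.map Fin.succ = t then 1 else 0 := by
  simp [bdyOp, bdyExpr, Pi.single_apply]

theorem bdyOp_orderEven {d : ℕ} (g : Matrix (Fin (d + 1)) (Fin (d + 1)) ℝ)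
    (l : Finset.Icc 2 ((d + 1) / 2 - 1)) (p t : Sym2 (Fin (d + 1))) :
    bdyOp g (.orderEven l p) t = traceOp g 1 ^ (l : ℕ) * if p = t then 1 else 0 := by
  simp [bdyOp, bdyExpr, Pi.single_apply, traceOp_eq_pow g l]

theorem map_succ_ne {d : ℕ} (p : Sym2 (Fin d)) (α : Fin (d + 1)) :
    p.map Fin.succ ≠ s(0, α) := by
  induction p with
  | _ i j => simp [Fin.succ_ne_zero]

section

variable {d : ℕ} {g : Matrix (Fin (d + 1)) (Fin (d + 1)) ℝ} {ξ ν : Fin (d + 1) → ℝ} {z : ℂ}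
  {c : BdyRow d → ℂ}

theorem sum_tangential_eq_ofReal (hν : ∀ i : Fin d, ν i.succ = 0) :
    (∑ j : Fin d, (g⁻¹ 0 j.succ : ℂ) * (ξ j.succ + ν j.succ * z : ℂ)) =
      ((∑ j : Fin d, g⁻¹ 0 j.succ * ξ j.succ : ℝ) : ℂ) := by
  simp [hν]

/-- The tangential components of `ζ` are real, so the imaginary part is `g^{00} ν_0 Im z`. -/
theorem raiseIndex_zero_im_ne_zero (hg : g⁻¹.IsSymm) (h00 : 0 < g⁻¹ 0 0)
    (hν : ∀ i : Fin d, ν i.succ = 0) (hν0 : ν 0 ≠ 0) (hz : z.im ≠ 0) :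
    (raiseIndex g (fun α => (ξ α + ν α * z : ℂ)) 0).im ≠ 0 := by
  rw [raiseIndex_zero_eq hg, sum_tangential_eq_ofReal hν]
  simpa using ⟨h00.ne', hν0, hz⟩

theorem coeff_order2b_eq_zero (hn : 2 ≤ d) (hg : g⁻¹.IsSymm) (h00 : 0 < g⁻¹ 0 0)
    (hν : ∀ i : Fin d, ν i.succ = 0) (hν0 : ν 0 ≠ 0) (hz : z.im ≠ 0)
    (hq : (alongHom ξ ν (traceOp g 1)).eval z = 0)
    (h : ∀ t, (∑ r, Polynomial.C (c r) * alongHom ξ ν (bdyOp g r t)).eval z = 0) :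
    c .order2bNormal = 0 ∧ ∀ i, c (.order2bTangential i) = 0 := by
  set ζ : Fin (d + 1) → ℂ := fun α => (ξ α + ν α * z : ℂ) with hζ
  have hq' : aeval ζ (traceOp g 1) = 0 := by rw [← hq, eval_alongHom]
  -- At `z` every multiple of `q` vanishes, and the rows of order 0 do not involve the unknowns
  -- `g_{0α}`.
  have hsum : ∀ α, c .order2bNormal * aeval ζ (bdyOp g .order2bNormal s(0, α)) +
      ∑ i, c (.order2bTangential i) * aeval ζ (bdyOp g (.order2bTangential i) s(0, α)) = 0 := by
    intro α
    have hl : ∀ l p, aeval ζ (bdyOp g (.orderEven l p) s(0, α)) = 0 := fun l p => by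
      have := (Finset.mem_Icc.1 l.2).1
      rw [bdyOp_orderEven, map_mul, map_pow, hq', zero_pow (by omega), zero_mul]
    have := h s(0, α)
    simp only [BdyRow.sum_eq, Polynomial.eval_add, Polynomial.eval_finsetSum, Polynomial.eval_mul,
      Polynomial.eval_C, eval_alongHom, ← hζ, bdyOp_order0, bdyOp_order2a, bdyOp_order3, hl, map_succ_ne, if_false,
      map_mul, map_zero, hq', zero_mul, mul_zero, Finset.sum_const_zero, zero_add, add_zero] at this
    exact this
  have hy := raiseIndex_zero_eq hg ζ
  have hb : (∑ j : Fin d, (g⁻¹ 0 j.succ : ℂ) * ζ j.succ) = _ := sum_tangential_eq_ofReal hν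
  have him0 : (raiseIndex g ζ 0).im ≠ 0 :=
    raiseIndex_zero_im_ne_zero (ξ := ξ) hg h00 hν hν0 hz
  have hd : (d : ℂ) ≠ 0 := by
    have : d ≠ 0 := by omega
    exact_mod_cast this
  -- This is `2 - n`, the numerator of `κ`; it would vanish in dimension two.
  have hd1 : (1 - d : ℂ) ≠ 0 := by
    rw [sub_ne_zero]
    have : 1 ≠ d := by omega
    exact_mod_cast this
  have ha : (g⁻¹ 0 0 : ℂ) ≠ 0 := by exact_mod_cast h00.ne'
  have hys := raiseIndex_zero_sq hg ζ
  rw [hq', mul_zero, zero_sub] at hys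
  refine order2b_coeff_eq_zero (κ := (1 - d) * (g⁻¹ 0 0) ^ 2 / d)
    (div_ne_zero (mul_ne_zero hd1 (pow_ne_zero 2 ha)) hd) hy rfl rfl hys ?_ ?_ ?_ ?_ ?_
  · exact fun h => him0 (by rw [h, Complex.zero_im])
  · rw [hb]
    exact fun h => him0 (by simpa using congrArg Complex.im h)
  · rw [hb]
    exact fun h => him0 (by simpa using congrArg Complex.im h)
  · simpa only [aeval_order2bNormal_zero, aeval_order2bTangential_zero hg] using hsum 0
  · intro k
    simpa only [aeval_order2bNormal_succ hg, aeval_order2bTangential_succ hg] using hsum k.succ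

theorem coeff_order3_eq_zero {p₁ : Polynomial ℂ}
    (hp : alongHom ξ ν (traceOp g 1) = (Polynomial.X - Polynomial.C z) * p₁)
    (hp₁ : p₁.eval z ≠ 0) (hy : raiseIndex g (fun α => (ξ α + ν α * z : ℂ)) 0 ≠ 0)
    (h : ∀ t, (Polynomial.X - Polynomial.C z) ^ 2 ∣
      ∑ r, Polynomial.C (c r) * alongHom ξ ν (bdyOp g r t))
    (hc : c .order2bNormal = 0 ∧ ∀ i, c (.order2bTangential i) = 0) (α : Fin (d + 1)) :
    c (.order3 α) = 0 := by
  set ζ : Fin (d + 1) → ℂ := fun α => (ξ α + ν α * z : ℂ) with hζ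
  have hsum : ∀ α, ∑ α', c (.order3 α') * aeval ζ (∑ η, ∑ β, C (g⁻¹ η β) * X η *
      (Pi.single s(0, α) 1 : Sym2 (Fin (d + 1)) → MvPolynomial (Fin (d + 1)) ℝ) s(α', β)) = 0 := by
    intro α
    -- The rows of even order at least 4 carry `q²`, so they drop out modulo `(X - z)²`.
    have hE : (Polynomial.X - Polynomial.C z) ^ 2 ∣
        ∑ l, ∑ p, Polynomial.C (c (.orderEven l p)) *
          alongHom ξ ν (bdyOp g (.orderEven l p) s(0, α)) := by
      refine Finset.dvd_sum fun l _ => Finset.dvd_sum fun p _ => Dvd.dvd.mul_left ?_ _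
      rw [bdyOp_orderEven, map_mul, map_pow, hp, mul_pow, mul_assoc]
      exact Dvd.dvd.mul_right (pow_dvd_pow _ (Finset.mem_Icc.1 l.2).1) _
    have h1 := h s(0, α)
    simp only [BdyRow.sum_eq, bdyOp_order0, bdyOp_order2a, map_succ_ne, hc.1, hc.2, if_false,
      map_zero, mul_zero, zero_mul, Finset.sum_const_zero, zero_add] at h1
    rw [dvd_add_left hE] at h1
    have h2 : ∀ α', Polynomial.C (c (.order3 α')) * alongHom ξ ν (bdyOp g (.order3 α') s(0, α)) =
        (Polynomial.X - Polynomial.C z) * (p₁ * (Polynomial.C (c (.order3 α')) *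
          alongHom ξ ν (∑ η, ∑ β, C (g⁻¹ η β) * X η *
            (Pi.single s(0, α) 1 : Sym2 (Fin (d + 1)) → MvPolynomial (Fin (d + 1)) ℝ)
              s(α', β)))) := by
      intro α'
      rw [bdyOp_order3, map_mul, hp]
      ring
    rw [Finset.sum_congr rfl fun α' _ => h2 α', ← Finset.mul_sum, ← Finset.mul_sum, sq,
      mul_dvd_mul_iff_left (Polynomial.X_sub_C_ne_zero z),
      Polynomial.dvd_iff_isRoot, Polynomial.IsRoot, Polynomial.eval_mul] at h1
    have h3 := (mul_eq_zero.1 h1).resolve_left hp₁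
    simpa only [Polynomial.eval_finsetSum, Polynomial.eval_mul, Polynomial.eval_C,
      eval_alongHom] using h3
  -- Column `(0, 0)` meets only the row `α = 0`. Once that coefficient is zero, column `(0, k)`
  -- meets only the row `k`.
  have h0 : c (.order3 0) = 0 := by
    have := hsum 0
    simp only [aeval_divergence_zero] at this
    simpa [hy] using this
  induction α using Fin.cases with
  | zero => exact h0
  | succ k =>
    have := hsum k.succ
    rw [Fin.sum_univ_succ, h0, zero_mul, zero_add] at this
    simp only [aeval_divergence_succ] at this
    simpa [hy] using this

theorem coeff_power_eq_zero {p₁ : Polynomial ℂ}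
    (hp : alongHom ξ ν (traceOp g 1) = (Polynomial.X - Polynomial.C z) * p₁)
    (hp₁ : p₁.eval z ≠ 0) (hk : 2 ≤ (d + 1) / 2)
    (h : ∀ t, (Polynomial.X - Polynomial.C z) ^ ((d + 1) / 2) ∣
      ∑ r, Polynomial.C (c r) * alongHom ξ ν (bdyOp g r t))
    (hc : c .order2bNormal = 0 ∧ ∀ i, c (.order2bTangential i) = 0)
    (hc3 : ∀ α, c (.order3 α) = 0) (r : BdyRow d) : c r = 0 := by
  -- Column `t` of the remaining sum is this polynomial evaluated at `q`. The orders 0, 2(a) and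
  -- `2l` occupy the distinct degrees 0, 1 and `l ≥ 2`, all below `n/2`.
  have hcoeff : ∀ (t : Sym2 (Fin (d + 1))) (k : ℕ), k < (d + 1) / 2 →
      Polynomial.coeff
        ((∑ p : Sym2 (Fin d), Polynomial.C (if p.map Fin.succ = t then c (.order0 p) else 0)) +
          (∑ p : Sym2 (Fin d),
            Polynomial.C (if p.map Fin.succ = t then c (.order2a p) else 0) * Polynomial.X ^ 1) +
          ∑ l : Finset.Icc 2 ((d + 1) / 2 - 1),
            Polynomial.C (c (.orderEven l t)) * Polynomial.X ^ (l : ℕ)) k = 0 := by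
    intro t
    refine Polynomial.X_pow_dvd_iff.1 (pow_dvd_of_pow_dvd_comp hp hp₁ _ _ ?_)
    refine (h t).trans (dvd_of_eq ?_)
    rw [BdyRow.sum_eq, hc.1]
    simp only [hc.2, hc3, map_zero, zero_mul, Finset.sum_const_zero, zero_add]
    rw [← Polynomial.coe_compRingHom_apply, map_add, map_add, map_sum, map_sum, map_sum, add_assoc]
    simp only [bdyOp_order0, bdyOp_order2a, bdyOp_orderEven, map_mul, map_pow]
    generalize alongHom ξ ν (traceOp g 1) = q
    refine congrArg₂ _ (Finset.sum_congr rfl fun p _ => ?_) (congrArg₂ _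
      (Finset.sum_congr rfl fun p _ => ?_) (Finset.sum_congr rfl fun l _ => ?_))
    · split_ifs <;> simp
    · split_ifs <;> simp
    · simp [apply_ite (alongHom ξ ν)]
  simp only [Polynomial.coeff_add, Polynomial.finsetSum_coeff, Polynomial.coeff_C_mul,
    Polynomial.coeff_X_pow, Polynomial.coeff_C] at hcoeff
  -- Injectivity ensures that a tangential column receives a single row of order 0 and a single row
  -- of order 2(a).
  have hinj := Sym2.map.injective (Fin.succ_injective d)
  have hl2 : ∀ l : Finset.Icc 2 ((d + 1) / 2 - 1), 2 ≤ (l : ℕ) ∧ (l : ℕ) < (d + 1) / 2 :=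
    fun l => by
      have := Finset.mem_Icc.1 l.2
      omega
  cases r with
  | order0 p =>
    have := hcoeff (p.map Fin.succ) 0 (by omega)
    have hl : ∀ l : Finset.Icc 2 ((d + 1) / 2 - 1), 0 ≠ (l : ℕ) := fun l => by
      have := hl2 l
      omega
    simpa [hl, hinj.eq_iff] using this
  | order2a p =>
    have := hcoeff (p.map Fin.succ) 1 (by omega)
    have hl : ∀ l : Finset.Icc 2 ((d + 1) / 2 - 1), 1 ≠ (l : ℕ) := fun l => by
      have := hl2 l
      omega
    simpa [hl, hinj.eq_iff] using this
  | order2bNormal => exact hc.1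
  | order2bTangential i => exact hc.2 i
  | order3 α => exact hc3 α
  | orderEven l p =>
    have := hcoeff p l (hl2 l).2
    have h0 : (l : ℕ) ≠ 0 := by have := hl2 l; omega
    have h1 : (l : ℕ) ≠ 1 := by have := hl2 l; omega
    simpa [h0, h1, Subtype.coe_inj] using this

end

/-! ### Roots of the symbol, `M⁺` and the complementing condition. -/

/-- The symbol of the trace operator on the line `ξ + T ν`. -/
theorem aeval_line_traceOp_one {d : ℕ} {g : Matrix (Fin (d + 1)) (Fin (d + 1)) ℝ}
    (hg : g⁻¹.IsSymm) {A : Type*} [CommRing A] [Algebra ℝ A] (ξ ν : Fin (d + 1) → ℝ) (T : A) :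
    aeval (fun α => algebraMap ℝ A (ξ α) + algebraMap ℝ A (ν α) * T) (traceOp g 1) =
      algebraMap ℝ A (eval ν (traceOp g 1)) * T ^ 2 +
        2 * algebraMap ℝ A (∑ α, ∑ β, g⁻¹ α β * ξ α * ν β) * T +
        algebraMap ℝ A (eval ξ (traceOp g 1)) := by
  have h : ∑ α, ∑ β, g⁻¹ α β * ν α * ξ β = ∑ α, ∑ β, g⁻¹ α β * ξ α * ν β := by
    rw [Finset.sum_comm]
    refine Finset.sum_congr rfl fun α _ => Finset.sum_congr rfl fun β _ => ?_
    rw [hg.apply α β]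
    ring
  rw [two_mul, add_mul]
  nth_rw 1 [← h]
  rw [eval_traceOp_one, eval_traceOp_one]
  simp only [traceOp, pow_one, map_sum, map_mul, aeval_C, aeval_X, Finset.sum_mul,
    ← Finset.sum_add_distrib]
  exact Finset.sum_congr rfl fun α _ => Finset.sum_congr rfl fun β _ => by ring

theorem eval_unitConormal_traceOp_one {d : ℕ} {g : Matrix (Fin (d + 1)) (Fin (d + 1)) ℝ}
    (h00 : 0 < g⁻¹ 0 0) : eval (unitConormal g) (traceOp g 1) = 1 := by
  have h : eval (unitConormal g) (traceOp g 1) = g⁻¹ 0 0 * (√(g⁻¹ 0 0))⁻¹ * (√(g⁻¹ 0 0))⁻¹ := by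
    simp [eval_traceOp_one, unitConormal, Pi.single_apply]
  rw [h, mul_assoc, ← mul_inv, Real.mul_self_sqrt h00.le, mul_inv_cancel₀ h00.ne']

/-- On a line in the direction of the unit conormal the symbol of the trace operator has two roots,
one on each side of the real axis. -/
theorem exists_alongHom_eq {d : ℕ} {g : Matrix (Fin (d + 1)) (Fin (d + 1)) ℝ} (hg : g.PosDef)
    (ξ : Fin (d + 1) → ℝ) (hξ : ∀ c : ℝ, ξ ≠ c • unitConormal g) :
    ∃ z z' : ℂ, 0 < z.im ∧ z'.im < 0 ∧ alongHom ξ (unitConormal g) (traceOp g 1) =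
      (Polynomial.X - Polynomial.C z) * (Polynomial.X - Polynomial.C z') := by
  have hsymm : g⁻¹.IsSymm := by simpa using hg.inv.isHermitian
  have h00 : 0 < g⁻¹ 0 0 := hg.inv.diag_pos
  set b := ∑ α, ∑ β, g⁻¹ α β * ξ α * unitConormal g β
  set q := eval ξ (traceOp g 1) with hq
  -- As `ν` is a unit covector, `q - b²` is the value of the form at `ξ - b ν`, which is nonzero
  -- because `ξ` is not a multiple of `ν`.
  have hdisc : 0 < q - b ^ 2 := by
    have h := aeval_line_traceOp_one hsymm ξ (unitConormal g) (-b)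
    have hpos := eval_traceOp_one_pos hg (ξ := fun α => ξ α + unitConormal g α * (-b)) fun h =>
      hξ b (by
        ext α
        have := congrFun h α
        simp only [Pi.zero_apply, Pi.smul_apply, smul_eq_mul] at this ⊢
        linarith)
    simp only [Algebra.algebraMap_self, RingHom.id_apply, eval_unitConormal_traceOp_one h00]
      at h
    rw [← coe_aeval_eq_eval] at hpos
    change 0 < aeval _ _ at hpos
    rw [h] at hpos
    linarith
  have hs := Real.sq_sqrt hdisc.le
  have hs0 := Real.sqrt_pos.2 hdisc
  set s := √(q - b ^ 2)
  refine ⟨-b + s * Complex.I, -b - s * Complex.I, by simpa using hs0, by simpa using hs0, ?_⟩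
  have h := aeval_line_traceOp_one hsymm ξ (unitConormal g) (Polynomial.X : Polynomial ℂ)
  simp only [eval_unitConormal_traceOp_one h00, Polynomial.algebraMap_apply, map_one, one_mul,
    Complex.coe_algebraMap, ← hq] at h
  rw [alongHom, h]
  have hc : (Polynomial.C (q : ℂ)) = Polynomial.C (b : ℂ) ^ 2 + Polynomial.C (s : ℂ) ^ 2 := by
    rw [← map_pow, ← map_pow, ← map_add]
    congr 1
    have : q = b ^ 2 + s ^ 2 := by linarith
    exact_mod_cast this
  have hI : (Polynomial.C Complex.I) ^ 2 = (-1 : Polynomial ℂ) := by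
    rw [← map_pow, Complex.I_sq, map_neg, map_one]
  rw [hc]
  simp only [map_add, map_sub, map_neg, map_mul]
  linear_combination ((Polynomial.C (s : ℂ)) ^ 2) * hI

theorem symbolAlong_apply {d : ℕ} {R T : Type*} (ξ ν : Fin (d + 1) → ℝ)
    (A : Matrix R T (MvPolynomial (Fin (d + 1)) ℝ)) (r : R) (t : T) :
    symbolAlong ξ ν A r t = alongHom ξ ν (A r t) := rfl

theorem symbolAlong_systemOp {d : ℕ} (g : Matrix (Fin (d + 1)) (Fin (d + 1)) ℝ)
    (ξ ν : Fin (d + 1) → ℝ) :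
    symbolAlong ξ ν (systemOp g) =
      Matrix.diagonal fun _ => alongHom ξ ν (traceOp g 1) ^ ((d + 1) / 2) := by
  ext1 s t
  rw [symbolAlong_apply, systemOp, Matrix.diagonal_apply, Matrix.diagonal_apply, traceOp_eq_pow]
  split_ifs
  · rw [map_pow]
  · rw [map_zero]

theorem mPlus_systemOp {d : ℕ} {g : Matrix (Fin (d + 1)) (Fin (d + 1)) ℝ}
    {ξ ν : Fin (d + 1) → ℝ} {z z' : ℂ} (hz : 0 < z.im) (hz' : z'.im < 0)
    (hp : alongHom ξ ν (traceOp g 1) =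
      (Polynomial.X - Polynomial.C z) * (Polynomial.X - Polynomial.C z')) :
    mPlus ξ ν (systemOp g) = (Polynomial.X - Polynomial.C z) ^
      ((d + 1) / 2 * Fintype.card (Sym2 (Fin (d + 1)))) := by
  have h0 := mul_ne_zero (Polynomial.X_sub_C_ne_zero z) (Polynomial.X_sub_C_ne_zero z')
  have h1 : ({z, z'} : Multiset ℂ).filter (fun z => 0 < z.im) = {z} := by
    rw [Multiset.insert_eq_cons, Multiset.filter_cons_of_pos (p := fun z : ℂ => 0 < z.im) _ hz, Multiset.filter_singleton,
      if_neg hz'.not_gt]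
    rfl
  rw [mPlus, symbolAlong_systemOp, Matrix.det_diagonal, Finset.prod_const, ← pow_mul, hp,
    Polynomial.roots_pow, Polynomial.roots_mul h0, Polynomial.roots_X_sub_C,
    Polynomial.roots_X_sub_C, Multiset.filter_nsmul, Multiset.singleton_add, Multiset.map_nsmul,
    Multiset.prod_nsmul]
  erw [h1]
  simp

theorem complementingAt_systemOp_bdyOp {d : ℕ} (hn : 4 ≤ d + 1)
    {g : Matrix (Fin (d + 1)) (Fin (d + 1)) ℝ} (hg : g.PosDef) :
    ComplementingAt (unitConormal g) (systemOp g) (bdyOp g) := by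
  intro ξ hξ c hc
  obtain ⟨z, z', hz, hz', hp⟩ := exists_alongHom_eq hg ξ hξ
  have hsymm : g⁻¹.IsSymm := by simpa using hg.inv.isHermitian
  have h00 : 0 < g⁻¹ 0 0 := hg.inv.diag_pos
  have hzz : (Polynomial.X - Polynomial.C z').eval z ≠ 0 := by
    simp only [Polynomial.eval_sub, Polynomial.eval_X, Polynomial.eval_C, ne_eq, sub_eq_zero]
    rintro rfl
    exact lt_asymm hz hz'
  have hcop : IsCoprime (Polynomial.X - Polynomial.C z) (Polynomial.X - Polynomial.C z') :=
    (Polynomial.irreducible_X_sub_C z).coprime_iff_not_dvd.2 fun h =>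
      hzz (Polynomial.dvd_iff_isRoot.1 h)
  have hdvd : ∀ t, (Polynomial.X - Polynomial.C z) ^ ((d + 1) / 2) ∣
      ∑ r, Polynomial.C (c r) * alongHom ξ (unitConormal g) (bdyOp g r t) := by
    intro t
    have h := hc t
    rw [mPlus_systemOp hz hz' hp] at h
    simp only [symbolAlong_systemOp, Matrix.adjugate_diagonal, Matrix.mul_diagonal,
      Finset.prod_const, Finset.card_erase_of_mem (Finset.mem_univ _), Finset.card_univ,
      symbolAlong_apply, ← mul_assoc, ← Finset.sum_mul] at h
    obtain ⟨M, hM⟩ : ∃ M, Fintype.card (Sym2 (Fin (d + 1))) = M + 1 :=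
      ⟨_, (Nat.sub_add_cancel Fintype.card_pos).symm⟩
    -- The adjugate contributes `q ^ ((n/2)(N - 1))`. Its factor in `X - z` cancels against `M⁺`,
    -- leaving exponent `n/2`; its factor in `X - z'` is coprime to `X - z`.
    rw [hM, Nat.add_sub_cancel, ← pow_mul, hp, mul_pow, mul_comm (_ ^ _) (_ ^ _), ← mul_assoc,
      mul_add, mul_one, pow_add, mul_comm (_ ^ _) (_ ^ ((d + 1) / 2)),
      mul_dvd_mul_iff_right (pow_ne_zero _ (Polynomial.X_sub_C_ne_zero z))] at h
    exact (hcop.pow).dvd_of_dvd_mul_right h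
  have hk : 2 ≤ (d + 1) / 2 := by omega
  have hν0 : unitConormal g 0 ≠ 0 := by
    simpa [unitConormal] using (Real.sqrt_pos.2 h00).ne'
  have hν : ∀ i : Fin d, unitConormal g i.succ = 0 := fun i => by simp [unitConormal]
  have hb := coeff_order2b_eq_zero (by omega) hsymm h00 hν hν0 hz.ne' (by simp [hp]) fun t =>
    Polynomial.dvd_iff_isRoot.1 ((dvd_pow_self _ (by omega)).trans (hdvd t))
  refine coeff_power_eq_zero hp hzz hk hdvd hb (coeff_order3_eq_zero hp hzz ?_
    (fun t => (pow_dvd_pow _ hk).trans (hdvd t)) hb)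
  exact fun h => raiseIndex_zero_im_ne_zero hsymm h00 hν hν0 hz.ne' (by rw [h, Complex.zero_im])

theorem proposition7p3 (d : ℕ) (hn : 4 ≤ d + 1) (heven : Even (d + 1))
    -- the coordinate domain, relatively open in the half space, and the metric on it
    (U : Set (Fin (d + 1) → ℝ))
    (hU : ∃ O : Set (Fin (d + 1) → ℝ), IsOpen O ∧ U = O ∩ {x | 0 ≤ x 0})
    (g : (Fin (d + 1) → ℝ) → Matrix (Fin (d + 1)) (Fin (d + 1)) ℝ)
    (hg : ContinuousOn g U) (hpos : ∀ x ∈ U, (g x).PosDef)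
    -- the system and the boundary operators, with arbitrary lower order terms
    (L : (Fin (d + 1) → ℝ) →
      Matrix (Sym2 (Fin (d + 1))) (Sym2 (Fin (d + 1))) (MvPolynomial (Fin (d + 1)) ℝ))
    (B : (Fin (d + 1) → ℝ) →
      Matrix (BdyRow d) (Sym2 (Fin (d + 1))) (MvPolynomial (Fin (d + 1)) ℝ))
    (hL : ∀ x ∈ U, ∀ s t, OrderLT (L x s t - systemOp (g x) s t) (d + 1))
    (hB : ∀ x ∈ boundaryPortion U, ∀ r t, OrderLT (B x r t - bdyOp (g x) r t) r.order) :
    AdmissibleWeights U (boundaryPortion U) L B (sysWeight d) (unknownWeight d) (bdyWeight d) ∧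
    (∀ K ⊆ U, IsCompact K →
      UniformlyEllipticOn K fun x => principalPart (sysWeight d) (unknownWeight d) (L x)) ∧
    ∀ x ∈ boundaryPortion U,
      2 * Fintype.card (BdyRow d) =
        (principalPart (sysWeight d) (unknownWeight d) (L x)).det.totalDegree ∧
      ComplementingAt (unitConormal (g x))
        (principalPart (sysWeight d) (unknownWeight d) (L x))
        (principalPart (bdyWeight d) (unknownWeight d) (B x)) := by
  refine ⟨admissibleWeights_of_orderLT heven hL hB, fun K hKU hK => ?_, fun x hx => ?_⟩
  · obtain ⟨a, ha, h⟩ := uniformlyEllipticOn_systemOp hKU hK hg hpos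
    refine ⟨a, ha, fun x hx ξ => ?_⟩
    simp only [principalPart_system heven (hL x (hKU hx))]
    exact h x hx ξ
  · rw [principalPart_system heven (hL x hx.1), principalPart_bdy (hB x hx),
      totalDegree_det_systemOp (hpos x hx.1), card_bdyRow hn heven]
    exact ⟨rfl, complementingAt_systemOp_bdyOp hn (hpos x hx.1)⟩
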